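/- **Setting.** All transfer matrices are real rational in $z$. A transfer matrix is *proper* if each entry has numerator degree at most its denominator degree; $\mathcal R_{\mathrm p}$ denotes the proper ones, and $\mathcal{RH}_\infty=\mathcal{RH}_2$ the stable ones, that is, the proper ones without poles outside the open unit disc. Let $$G=\begin{bmatrix}G_{11}&G_{12}\\G_{21}&G_{22}\end{bmatrix},\quad G_{11}=C_1(zI-A)^{-1}B_1,\ \ G_{12}=C_1(zI-A)^{-1}B_2+D_{12},\ \ G_{21}=C_2(zI-A)^{-1}B_1+D_{21},\ \ G_{22}=C_2(zI-A)^{-1}B_2$$ be a discrete-time plant with real matrices, whose second input $u$ has dimension $p_2$ and whose second output $y$ has dimension $q_2$, and with $(A,B_2,C_2)$ stabilizable and detectable. A controller $u=\mathcal K y$ *internally stabilizes* $G$ if the loop with signals $v_1,v_2$ added at $u$ and $y$ is well-posed and the nine transfer matrices from $(w,v_1,v_2)$ to (first output, $u$, $y$) are stable; it internally stabilizes $G_{22}$ if this holds for the four transfer matrices from $(v_1,v_2)$ to $(u,y)$. Let $\hat M,\hat N,\hat X,\hat Y,\tilde M,\tilde N,\tilde X,\tilde Y\in\mathcal{RH}_\infty$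 be any doubly-coprime factorization of $G_{22}$: $G_{22}=\hat N\hat M^{-1}=\tilde M^{-1}\tilde N$ and $$\begin{bmatrix}\tilde X&-\tilde Y\\-\tilde N&\tilde M\end{bmatrix}\begin{bmatrix}\hat M&\hat Y\\\hat N&\hat X\end{bmatrix}=I.$$ Let $N\ge 0$. Put $\mathcal X_{\mathrm p}=\bigoplus_{i=0}^N z^{-i}\mathbb C^{p_2\times q_2}$ and $\mathcal{RX}_{\mathrm p}=\bigoplus_{i=0}^N z^{-i}\mathbb R^{p_2\times q_2}$, and let $\mathbb P_{\mathcal X_{\mathrm p}}$ be the orthogonal projection onto $\mathcal X_{\mathrm p}$ in $\mathcal H_2$, with inner product $\langle F,H\rangle=\sum_{i\ge0}\operatorname{Tr}(F_iH_i^*)$ where $F=\sum_{i\ge 0}z^{-i}F_i$ and $H=\sum_{i\ge 0}z^{-i}H_i$. Let $\mathcal Y=\bigoplus_{i=1}^N z^{-i}\mathcal Y_i$, where each $\mathcal Y_i\subset\mathbb R^{p_2\times q_2}$ is the space of real matrices with a given sparsity pattern, and let $\mathcal S=\mathcal Y\oplus z^{-(N+1)}\mathcal R_{\mathrm p}$.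 Assume that $\mathcal S$ is quadratically invariant with respect to $G_{22}$: $\mathcal K G_{22}\mathcal K\in\mathcal S$ for all $\mathcal K\in\mathcal S$. **Theorem.** For all $U\in z^{-(N+1)}\mathcal{RH}_\infty$ and $V\in\mathcal{RX}_{\mathrm p}$ the matrix $\hat X-\hat N(U+V)$ is invertible over the field of rational functions. For every transfer matrix $\mathcal K$ of size $p_2\times q_2$, the following are equivalent: 1. $\mathcal K\in\mathcal S$ and $\mathcal K$ internally stabilizes $G$; 2. $\mathcal K\in\mathcal S$ and $\mathcal K$ internally stabilizes $G_{22}$; 3. there are $U\in z^{-(N+1)}\mathcal{RH}_\infty$ and $V\in\mathcal{RX}_{\mathrm p}$ such that $$\mathcal K=(\hat Y-\hat M(U+V))(\hat X-\hat N(U+V))^{-1}\qquad\text{and}\qquad \mathbb P_{\mathcal X_{\mathrm p}}\big((\hat Y-\hat MV)\tilde M\big)\in\mathcal Y.$$ -/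

import Mathlib

open scoped Polynomial

noncomputable section

/-- Real rational transfer matrices in the complex frequency `z` (`RatFunc.X` is `z`), with `a`
outputs and `b` inputs. -/
abbrev TransferMatrix (a b : ℕ) := Matrix (Fin a) (Fin b) (RatFunc ℝ)

namespace TransferMatrix

/-- A constant real matrix, as a transfer matrix. -/
def const {a b : ℕ} (M : Matrix (Fin a) (Fin b) ℝ) : TransferMatrix a b :=
  M.map RatFunc.C

/-- The delay `1 / z ^ k`. -/
def delay (k : ℕ) : RatFunc ℝ := (RatFunc.X⁻¹) ^ k

/-- A scalar rational function is proper if the degree of its numerator is at most the degree of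
its denominator. -/
def ProperEntry (f : RatFunc ℝ) : Prop := f.intDegree ≤ 0

/-- A scalar rational function is stable if it is proper and all its (complex) poles lie in the
open unit disc. The fraction `f.num / f.denom` is in lowest terms. -/
def StableEntry (f : RatFunc ℝ) : Prop :=
  ProperEntry f ∧ ∀ w : ℂ, Polynomial.aeval w f.denom = 0 → ‖w‖ < 1

/-- The space of proper real rational transfer matrices. -/
def RRp (a b : ℕ) : Set (TransferMatrix a b) :=
  {F | ∀ i j, ProperEntry (F i j)}

/-- The space of stable (proper, no poles outside the open unit disc) real rational transfer
matrices, `RH∞ = RH₂`. -/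
def RHinf (a b : ℕ) : Set (TransferMatrix a b) :=
  {F | ∀ i j, StableEntry (F i j)}

/-- The space `(1 / z ^ k) M` for a set `M` of transfer matrices. -/
def delayed {a b : ℕ} (k : ℕ) (M : Set (TransferMatrix a b)) : Set (TransferMatrix a b) :=
  {F | ∃ H ∈ M, F = delay k • H}

/-- Real FIR transfer matrices `∑_{i=0}^N (1 / z ^ i) V_i`. -/
def RXp (N a b : ℕ) : Set (TransferMatrix a b) :=
  {F | ∃ V : ℕ → Matrix (Fin a) (Fin b) ℝ,
    F = ∑ i ∈ Finset.range (N + 1), delay i • const (V i)}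

/-- The matrices whose support is contained in the given sparsity pattern. -/
def Sparse {a b : ℕ} (pat : Fin a → Fin b → Prop) : Set (Matrix (Fin a) (Fin b) ℝ) :=
  {M | ∀ i j, ¬ pat i j → M i j = 0}

/-- `Y = ⨁_{i=1}^N (1 / z ^ i) Y_i`, where `Y_i` is the space of real matrices with sparsity
pattern `pat i`. -/
def YSpace {a b : ℕ} (N : ℕ) (pat : ℕ → Fin a → Fin b → Prop) : Set (TransferMatrix a b) :=
  {F | ∃ V : ℕ → Matrix (Fin a) (Fin b) ℝ, (∀ i ∈ Finset.Icc 1 N, V i ∈ Sparse (pat i)) ∧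
    F = ∑ i ∈ Finset.Icc 1 N, delay i • const (V i)}

/-- The strongly connected delay pattern `S = Y ⊕ (1 / z ^ (N + 1)) RRp`. -/
def SSpace {a b : ℕ} (N : ℕ) (pat : ℕ → Fin a → Fin b → Prop) : Set (TransferMatrix a b) :=
  {F | ∃ H ∈ YSpace N pat, ∃ R ∈ delayed (N + 1) (RRp a b), F = H + R}

/-- `S` is quadratically invariant with respect to `G`. -/
def QuadraticallyInvariant {a b : ℕ} (S : Set (TransferMatrix a b)) (G : TransferMatrix b a) :
    Prop :=
  ∀ K ∈ S, K * G * K ∈ S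

/-! ### Power series in `1 / z` and the orthogonal projection onto the FIR matrices -/

/-- The substitution `z ↦ t⁻¹` from real polynomials to Laurent series in `t`. -/
def substInv : ℝ[X] →+* LaurentSeries ℝ :=
  Polynomial.eval₂RingHom HahnSeries.C (HahnSeries.single (-1 : ℤ) (1 : ℝ))

/-- The substitution `z ↦ t⁻¹` is injective on polynomials. -/
theorem substInv_nonZeroDivisors :
    nonZeroDivisors ℝ[X] ≤ (nonZeroDivisors (LaurentSeries ℝ)).comap substInv := by
  refine nonZeroDivisors_le_comap_nonZeroDivisors_of_injective _ ?_
  rw [injective_iff_map_eq_zero]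
  intro p hp
  ext k
  have h := congrArg (fun s : LaurentSeries ℝ => s.coeff (-(k : ℤ))) hp
  simp only [substInv, Polynomial.coe_eval₂RingHom, Polynomial.eval₂_eq_sum_range, HahnSeries.single_pow,
    HahnSeries.coeff_zero, HahnSeries.coeff_sum, HahnSeries.C_apply,
    HahnSeries.single_mul_single, HahnSeries.coeff_single, one_pow, mul_one, zero_add,
    nsmul_eq_mul, mul_neg, neg_inj, Nat.cast_inj] at h
  rw [Polynomial.coeff_zero]
  by_cases hk : k ≤ p.natDegree
  · rw [Finset.sum_eq_single k (fun i _ hi => if_neg (Ne.symm hi))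
      (fun hk' => absurd (Finset.mem_range.2 (by omega)) hk'), if_pos rfl] at h
    exact h
  · exact Polynomial.coeff_eq_zero_of_natDegree_lt (by omega)

/-- The expansion of a rational function at `z = ∞`, as a Laurent series in `t = 1 / z`. -/
def expandAtInfinity : RatFunc ℝ →+* LaurentSeries ℝ :=
  RatFunc.liftRingHom substInv substInv_nonZeroDivisors

/-- The coefficients `F_i` of `F(z) = ∑_{i ≥ 0} (1 / z ^ i) F_i` (for proper `F`), as complex
matrices. -/
def coeffs {a b : ℕ} (F : TransferMatrix a b) (i : ℕ) : Matrix (Fin a) (Fin b) ℂ :=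
  Matrix.of fun r s => (((expandAtInfinity (F r s)).coeff (i : ℤ) : ℝ) : ℂ)

/-- The `H₂` inner product `⟨G, H⟩ = ∑_i Tr (G_i H_i^*)`, in terms of the power series
coefficients. -/
def htwoInner {a b : ℕ} (G H : ℕ → Matrix (Fin a) (Fin b) ℂ) : ℂ :=
  ∑' i, (G i * (H i).conjTranspose).trace

/-- The (coefficient sequences of the) complex FIR matrices `X_p = ⨁_{i=0}^N (1 / z ^ i) ℂ^{a × b}`.
-/
def Xp (N a b : ℕ) : Set (ℕ → Matrix (Fin a) (Fin b) ℂ) :=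
  {W | ∀ i, N < i → W i = 0}

/-- `P` is the orthogonal projection of `F` onto `X_p`, with respect to the `H₂` inner product:
`P ∈ X_p` and `F - P ⟂ X_p`. -/
def IsXpProjection {a b : ℕ} (N : ℕ) (F P : TransferMatrix a b) : Prop :=
  P ∈ RRp a b ∧ coeffs P ∈ Xp N a b ∧
    ∀ W ∈ Xp N a b, htwoInner (coeffs F - coeffs P) W = 0

/-! ### Doubly-coprime factorizations -/

/-- Eight stable transfer matrices forming a doubly-coprime factorization of `G`. -/
structure IsDoublyCoprimeFactorization {p q : ℕ} (G : TransferMatrix q p)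
    (Mh : TransferMatrix p p) (Nh : TransferMatrix q p)
    (Xh : TransferMatrix q q) (Yh : TransferMatrix p q)
    (Mt : TransferMatrix q q) (Nt : TransferMatrix q p)
    (Xt : TransferMatrix p p) (Yt : TransferMatrix p q) : Prop where
  Mh_stable : Mh ∈ RHinf p p
  Nh_stable : Nh ∈ RHinf q p
  Xh_stable : Xh ∈ RHinf q q
  Yh_stable : Yh ∈ RHinf p q
  Mt_stable : Mt ∈ RHinf q q
  Nt_stable : Nt ∈ RHinf q p
  Xt_stable : Xt ∈ RHinf p p
  Yt_stable : Yt ∈ RHinf p q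
  Mh_unit : IsUnit Mh.det
  Mt_unit : IsUnit Mt.det
  right_fact : G = Nh * Mh⁻¹
  left_fact : G = Mt⁻¹ * Nt
  bezout : Matrix.fromBlocks Xt (-Yt) (-Nt) Mt * Matrix.fromBlocks Mh Yh Nh Xh = 1

/-! ### The feedback loop and internal stability -/

/-- The operator `(u, y) ↦ (u - K y, y - G u)` of the loop `u = K y + v₁`, `y = G u + v₂`. -/
def loop {p q : ℕ} (G : TransferMatrix q p) (K : TransferMatrix p q) :
    Matrix (Fin p ⊕ Fin q) (Fin p ⊕ Fin q) (RatFunc ℝ) :=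
  Matrix.fromBlocks 1 (-K) (-G) 1

/-- All entries are stable. -/
def Stable {ι κ : Type} (F : Matrix ι κ (RatFunc ℝ)) : Prop :=
  ∀ i j, StableEntry (F i j)

/-- `K` internally stabilizes `G`: the loop `u = K y + v₁`, `y = G u + v₂` is well-posed, and the
four transfer matrices from the injected signals `(v₁, v₂)` to `(u, y)` are stable. -/
def InternallyStabilizes {p q : ℕ} (G : TransferMatrix q p) (K : TransferMatrix p q) : Prop :=
  IsUnit (loop G K).det ∧ Stable (loop G K)⁻¹

end TransferMatrix

/-- State-space data of the plant
`x⁺ = A x + B₁ w + B₂ u`, `ζ = C₁ x + D₁₂ u`, `y = C₂ x + D₂₁ w`,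
with state dimension `n`, inputs `w`, `u` of dimensions `p₁`, `p₂` and outputs `ζ`, `y` of
dimensions `q₁`, `q₂`. -/
structure Plant (n p₁ p₂ q₁ q₂ : ℕ) where
  A : Matrix (Fin n) (Fin n) ℝ
  B₁ : Matrix (Fin n) (Fin p₁) ℝ
  B₂ : Matrix (Fin n) (Fin p₂) ℝ
  C₁ : Matrix (Fin q₁) (Fin n) ℝ
  C₂ : Matrix (Fin q₂) (Fin n) ℝ
  D₁₂ : Matrix (Fin q₁) (Fin p₂) ℝ
  D₂₁ : Matrix (Fin q₂) (Fin p₁) ℝ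

/-- All eigenvalues lie in the open unit disc. -/
def IsSchur {n : ℕ} (A : Matrix (Fin n) (Fin n) ℝ) : Prop :=
  ∀ w ∈ spectrum ℂ (A.map ((↑) : ℝ → ℂ)), ‖w‖ < 1

/-- `(A, B)` is stabilizable. -/
def Stabilizable {n p : ℕ} (A : Matrix (Fin n) (Fin n) ℝ) (B : Matrix (Fin n) (Fin p) ℝ) : Prop :=
  ∃ F : Matrix (Fin p) (Fin n) ℝ, IsSchur (A + B * F)

/-- `(A, C)` is detectable. -/
def Detectable {n q : ℕ} (A : Matrix (Fin n) (Fin n) ℝ) (C : Matrix (Fin q) (Fin n) ℝ) : Prop :=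
  ∃ L : Matrix (Fin n) (Fin q) ℝ, IsSchur (A + L * C)

namespace Plant

open TransferMatrix

variable {n p₁ p₂ q₁ q₂ : ℕ} (G : Plant n p₁ p₂ q₁ q₂)

/-- The resolvent `(z I - A)⁻¹`. -/
def resolvent : TransferMatrix n n :=
  ((RatFunc.X : RatFunc ℝ) • (1 : TransferMatrix n n) - const G.A)⁻¹

/-- The transfer matrix from `w` to `ζ`. -/
def G₁₁ : TransferMatrix q₁ p₁ := const G.C₁ * G.resolvent * const G.B₁

/-- The transfer matrix from `u` to `ζ`. -/
def G₁₂ : TransferMatrix q₁ p₂ := const G.C₁ * G.resolvent * const G.B₂ + const G.D₁₂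

/-- The transfer matrix from `w` to `y`. -/
def G₂₁ : TransferMatrix q₂ p₁ := const G.C₂ * G.resolvent * const G.B₁ + const G.D₂₁

/-- The transfer matrix from `u` to `y`. -/
def G₂₂ : TransferMatrix q₂ p₂ := const G.C₂ * G.resolvent * const G.B₂

/-- `K` internally stabilizes the plant: the loop `ζ = G₁₁ w + G₁₂ u`, `y = G₂₁ w + G₂₂ u + v₂`,
`u = K y + v₁` is well-posed, and the nine transfer matrices from `(w, v₁, v₂)` to `(ζ, u, y)` are
stable. They are grouped as: `(v₁, v₂)` to `(u, y)`; `w` to `(u, y)`; `(v₁, v₂)` to `ζ`;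
`w` to `ζ`. -/
def InternallyStabilizedBy (K : TransferMatrix p₂ q₂) : Prop :=
  IsUnit (loop G.G₂₂ K).det ∧
  Stable (loop G.G₂₂ K)⁻¹ ∧
  Stable ((loop G.G₂₂ K)⁻¹ * Matrix.fromRows (0 : TransferMatrix p₂ p₁) G.G₂₁) ∧
  Stable (Matrix.fromCols G.G₁₂ (0 : TransferMatrix q₁ q₂) * (loop G.G₂₂ K)⁻¹) ∧
  Stable (G.G₁₁ + Matrix.fromCols G.G₁₂ (0 : TransferMatrix q₁ q₂) * (loop G.G₂₂ K)⁻¹ *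
    Matrix.fromRows (0 : TransferMatrix p₂ p₁) G.G₂₁)

end Plant

end

open TransferMatrix

noncomputable section

namespace TransferMatrix

/-! ### The rings of proper and of stable rational functions -/

/-! For a stable parameter Q put J = (Yh - Mh Q) Mt. The Bezout identity gives (Xh - Nh Q) Mt = 1 +
G₂₂ J. Because G₂₂ is strictly proper, the right side has a proper inverse
(`one_add_strictly_proper_matrix`), so Xh - Nh Q is always invertible. The fractions K = (Yh - Mh
Q)(Xh - Nh Q)⁻¹ with Q stable are exactly the controllers stabilizing G₂₂ (`exists_parameter`,
`internallyStabilizes`).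

While K is fractional in Q, J is affine in Q, and K (1 + G₂₂ J) = J. Quadratic invariance puts every
K (G₂₂ K)^i in S. Unrolling J = K + J G₂₂ K a finite number of times leaves a remainder with N + 1
delays, which S contains automatically; hence K in S gives J in S (`closedLoop_mem`). Exchanging K
and J and replacing G₂₂ by -G₂₂ gives the converse, so K is in S exactly when J is.

Membership of J in S concerns only its coefficients of index at most N. With Q = U + V, the term Mh
U Mt has N + 1 delays and drops out, which leaves a condition on V alone.

For the full plant, the resolvent in G₁₁, G₁₂, G₂₁ may have unstable poles. Output injection and
state feedback express it through stable resolvents and the stable blocks of the loop around G₂₂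
(`internallyStabilizedBy_iff`). -/

theorem ProperEntry.mul {f g : RatFunc ℝ} (hf : ProperEntry f) (hg : ProperEntry g) :
    ProperEntry (f * g) := by
  unfold ProperEntry at *
  by_cases hf0 : f = 0
  · simp [hf0]
  by_cases hg0 : g = 0
  · simp [hg0]
  rw [RatFunc.intDegree_mul hf0 hg0]
  omega

theorem ProperEntry.add {f g : RatFunc ℝ} (hf : ProperEntry f) (hg : ProperEntry g) :
    ProperEntry (f + g) := by
  unfold ProperEntry at *
  by_cases hg0 : g = 0
  · simpa [hg0] using hf
  by_cases h0 : f + g = 0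
  · simp [h0]
  exact (RatFunc.intDegree_add_le hg0 h0).trans (max_le hf hg)

theorem denom_neg_dvd (f : RatFunc ℝ) : (-f).denom ∣ f.denom := by
  rw [RatFunc.denom_dvd f.denom_ne_zero]
  refine ⟨-f.num, ?_⟩
  rw [map_neg, neg_div, RatFunc.num_div_denom]

/-- Poles may be located with any multiple of the reduced denominator, so cancellations in sums and
products need not be tracked. -/
theorem StableEntry.of_denom_dvd {f : RatFunc ℝ} (hf : ProperEntry f) {q : ℝ[X]}
    (hd : f.denom ∣ q) (hq : ∀ w : ℂ, Polynomial.aeval w q = 0 → ‖w‖ < 1) : StableEntry f := by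
  refine ⟨hf, fun w hw => hq w ?_⟩
  obtain ⟨r, rfl⟩ := hd
  rw [map_mul, hw, zero_mul]

theorem aeval_mul_roots {p q : ℝ[X]} (hp : ∀ w : ℂ, Polynomial.aeval w p = 0 → ‖w‖ < 1)
    (hq : ∀ w : ℂ, Polynomial.aeval w q = 0 → ‖w‖ < 1) (w : ℂ)
    (h : Polynomial.aeval w (p * q) = 0) : ‖w‖ < 1 := by
  rw [map_mul, mul_eq_zero] at h
  exact h.elim (hp w) (hq w)

theorem properEntry_C (c : ℝ) : ProperEntry (RatFunc.C c) := by simp [ProperEntry]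

theorem stableEntry_C (c : ℝ) : StableEntry (RatFunc.C c) :=
  ⟨properEntry_C c, fun w hw => by simp at hw⟩

/-- The ring of proper real rational functions. -/
def properSubring : Subring (RatFunc ℝ) where
  carrier := {f | ProperEntry f}
  mul_mem' := ProperEntry.mul
  one_mem' := by simp [ProperEntry]
  add_mem' := ProperEntry.add
  zero_mem' := by simp [ProperEntry]
  neg_mem' := by intro f hf; simpa [ProperEntry] using hf

/-- The ring of stable real rational functions. -/
def stableSubring : Subring (RatFunc ℝ) where
  carrier := {f | StableEntry f}
  mul_mem' := fun hf hg => StableEntry.of_denom_dvd (hf.1.mul hg.1) (RatFunc.denom_mul_dvd _ _)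
    (aeval_mul_roots hf.2 hg.2)
  one_mem' := by simpa using stableEntry_C 1
  add_mem' := fun hf hg => StableEntry.of_denom_dvd (hf.1.add hg.1) (RatFunc.denom_add_dvd _ _)
    (aeval_mul_roots hf.2 hg.2)
  zero_mem' := by simpa using stableEntry_C 0
  neg_mem' := by
    intro f hf
    exact StableEntry.of_denom_dvd (by simpa [ProperEntry] using hf.1) (denom_neg_dvd f) hf.2

theorem stableSubring_le : stableSubring ≤ properSubring := fun _ h => h.1

theorem X_inv_stable : (RatFunc.X : RatFunc ℝ)⁻¹ ∈ stableSubring := by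
  refine StableEntry.of_denom_dvd (q := Polynomial.X) (by simp [ProperEntry]) ?_ ?_
  · have h := RatFunc.denom_inv_dvd (K := ℝ) RatFunc.X_ne_zero
    rwa [RatFunc.num_X] at h
  · intro w hw
    simp at hw
    simp [hw]

theorem delay_stable (k : ℕ) : delay k ∈ stableSubring := pow_mem X_inv_stable k

theorem delay_mul (j k : ℕ) : delay j * delay k = delay (j + k) := (pow_add _ _ _).symm

theorem delay_zero : delay 0 = 1 := pow_zero _

/-- A perturbation of `1` by a strictly proper function is a unit of the ring of proper
functions. -/
theorem one_add_strictly_proper {s : RatFunc ℝ} (hs : s ∈ properSubring) :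
    1 + (RatFunc.X)⁻¹ * s ≠ 0 ∧ (1 + (RatFunc.X)⁻¹ * s)⁻¹ ∈ properSubring := by
  set t := (RatFunc.X : RatFunc ℝ)⁻¹ * s with ht
  have htd : t ≠ 0 → t.intDegree < 0 := by
    intro h
    have hs0 : s ≠ 0 := right_ne_zero_of_mul h
    rw [ht, RatFunc.intDegree_mul (inv_ne_zero RatFunc.X_ne_zero) hs0]
    simp only [RatFunc.intDegree_inv, RatFunc.intDegree_X]
    have : s.intDegree ≤ 0 := hs
    omega
  have h0 : 1 + t ≠ 0 := by
    intro h
    have h1 : t = -1 := by linear_combination h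
    have := htd (by rw [h1]; simp)
    rw [h1] at this
    simp at this
  refine ⟨h0, ?_⟩
  change RatFunc.intDegree _ ≤ 0
  rw [RatFunc.intDegree_inv]
  by_contra! hc
  by_cases ht0 : t = 0
  · simp [ht0] at hc
  -- If 1 + t had negative degree, so would 1 = (1 + t) + (-t).
  have h1 := RatFunc.intDegree_add_le (x := 1 + t) (y := -t) (by simpa using ht0) (by simp)
  rw [add_neg_cancel_right, RatFunc.intDegree_neg, RatFunc.intDegree_one] at h1
  have := htd ht0
  rcases le_max_iff.1 h1 with h | h <;> omega

/-- A proper function is a constant plus a strictly proper function, with the same poles. -/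
theorem exists_eq_C_add {f : RatFunc ℝ} (hf : f ∈ properSubring) :
    ∃ (c : ℝ) (g : RatFunc ℝ), g ∈ properSubring ∧ (f ∈ stableSubring → g ∈ stableSubring) ∧
      f = RatFunc.C c + (RatFunc.X)⁻¹ * g := by
  have hX : (RatFunc.X : RatFunc ℝ) ≠ 0 := RatFunc.X_ne_zero
  -- This is the value of f at infinity, the denominator being monic. Subtracting it kills the
  -- coefficient of degree `f.denom.natDegree` in the numerator, which leaves room for the factor X
  -- in g.
  set c := f.num.coeff f.denom.natDegree with hc
  set p := f.num - Polynomial.C c * f.denom with hp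
  have hd0 := f.denom_ne_zero
  have hdeg : f.num.natDegree ≤ f.denom.natDegree := by
    have : f.intDegree ≤ 0 := hf
    unfold RatFunc.intDegree at this
    omega
  have hfp : f - RatFunc.C c = algebraMap _ _ p / algebraMap _ _ f.denom := by
    rw [hp, map_sub, map_mul, sub_div, RatFunc.num_div_denom, mul_div_cancel_right₀,
      RatFunc.algebraMap_C]
    simpa using hd0
  set g := RatFunc.X * (f - RatFunc.C c) with hg
  have hgp : g = algebraMap _ _ (Polynomial.X * p) / algebraMap _ _ f.denom := by
    rw [hg, hfp, map_mul, RatFunc.algebraMap_X, mul_div_assoc]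
  have hgd : g.denom ∣ f.denom := by
    rw [hgp]; exact RatFunc.denom_div_dvd _ _
  have hgproper : g ∈ properSubring := by
    by_cases hp0 : p = 0
    · rw [hgp, hp0]; simp [properSubring.zero_mem]
    change RatFunc.intDegree _ ≤ 0
    rw [hgp, RatFunc.intDegree_div (by simpa using And.intro hX hp0) (by simpa using hd0),
      RatFunc.intDegree_polynomial, RatFunc.intDegree_polynomial,
      Polynomial.natDegree_X_mul hp0]
    have h1 : p.natDegree ≤ f.denom.natDegree := by
      refine (Polynomial.natDegree_sub_le _ _).trans (max_le hdeg ?_)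
      exact Polynomial.natDegree_C_mul_le _ _
    have h2 : p.coeff f.denom.natDegree = 0 := by
      rw [hp, Polynomial.coeff_sub, Polynomial.coeff_C_mul,
        Polynomial.coeff_natDegree, f.monic_denom.leadingCoeff]
      simp [hc]
    have h3 : p.natDegree ≠ f.denom.natDegree := by
      intro h
      rw [← h, Polynomial.coeff_natDegree, Polynomial.leadingCoeff_eq_zero] at h2
      exact hp0 h2
    push_cast
    omega
  refine ⟨c, g, hgproper, fun hs => StableEntry.of_denom_dvd hgproper hgd hs.2, ?_⟩
  rw [hg, inv_mul_cancel_left₀ hX]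
  ring

/-! ### Expansion at infinity -/

theorem coeff_substInv (p : ℝ[X]) (k : ℤ) :
    (substInv p).coeff k = if k ≤ 0 then p.coeff k.natAbs else 0 := by
  induction p using Polynomial.induction_on' with
  | add a b ha hb =>
    rw [map_add, HahnSeries.coeff_add, ha, hb]
    split_ifs <;> simp
  | monomial i a =>
    simp only [substInv, Polynomial.coe_eval₂RingHom, Polynomial.eval₂_monomial,
      HahnSeries.single_pow, HahnSeries.C_apply, HahnSeries.single_mul_single, one_pow, mul_one,
      zero_add, nsmul_eq_mul, mul_neg, HahnSeries.coeff_single, Polynomial.coeff_monomial]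
    split_ifs <;> first | rfl | omega

theorem substInv_ne_zero {p : ℝ[X]} (hp : p ≠ 0) : substInv p ≠ 0 := by
  intro h
  have h1 := congrArg (fun s : LaurentSeries ℝ => s.coeff (-(p.natDegree : ℤ))) h
  simp [coeff_substInv, hp] at h1

theorem order_substInv {p : ℝ[X]} (hp : p ≠ 0) : (substInv p).order = -(p.natDegree : ℤ) := by
  apply le_antisymm
  · apply HahnSeries.order_le_of_coeff_ne_zero
    simp [coeff_substInv, hp]
  · by_contra! hlt
    have h := mt HahnSeries.coeff_order_eq_zero.1 (substInv_ne_zero hp)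
    apply h
    rw [coeff_substInv]
    split_ifs
    · exact Polynomial.coeff_eq_zero_of_natDegree_lt (by omega)
    · rfl

theorem expandAtInfinity_algebraMap (p : ℝ[X]) :
    expandAtInfinity (algebraMap _ _ p) = substInv p := RatFunc.liftRingHom_algebraMap _ _ _

theorem expandAtInfinity_C (c : ℝ) : expandAtInfinity (RatFunc.C c) = HahnSeries.C c := by
  rw [← RatFunc.algebraMap_C, expandAtInfinity_algebraMap]
  simp [substInv]

theorem expandAtInfinity_X_inv :
    expandAtInfinity (RatFunc.X)⁻¹ = HahnSeries.single (1 : ℤ) (1 : ℝ) := by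
  rw [map_inv₀, ← RatFunc.algebraMap_X, expandAtInfinity_algebraMap]
  apply inv_eq_of_mul_eq_one_left
  simp [substInv, HahnSeries.single_mul_single]

theorem expandAtInfinity_delay (k : ℕ) :
    expandAtInfinity (delay k) = HahnSeries.single (k : ℤ) (1 : ℝ) := by
  rw [delay, map_pow, expandAtInfinity_X_inv, HahnSeries.single_pow]
  simp

/-- The expansion of a nonzero f has order deg denom - deg num, which is nonnegative when f is
proper. -/
theorem coeff_expandAtInfinity_of_neg {f : RatFunc ℝ} (hf : f ∈ properSubring) {k : ℤ}
    (hk : k < 0) : (expandAtInfinity f).coeff k = 0 := by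
  by_cases hf0 : f = 0
  · simp [hf0]
  apply HahnSeries.coeff_eq_zero_of_lt_order
  have hn := RatFunc.num_ne_zero hf0
  have h1 : expandAtInfinity f * substInv f.denom = substInv f.num := by
    rw [← expandAtInfinity_algebraMap, ← expandAtInfinity_algebraMap, ← map_mul]
    rw [(eq_div_iff (by simpa using f.denom_ne_zero)).1 (RatFunc.num_div_denom f).symm]
  have h2 := congrArg HahnSeries.order h1
  rw [HahnSeries.order_mul (by simpa using hf0) (substInv_ne_zero f.denom_ne_zero),
    order_substInv hn, order_substInv f.denom_ne_zero] at h2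
  have h3 : f.intDegree ≤ 0 := hf
  unfold RatFunc.intDegree at h3
  omega

theorem coeff_expandAtInfinity_delay_mul (k : ℕ) (f : RatFunc ℝ) (i : ℤ) :
    (expandAtInfinity (delay k * f)).coeff i = (expandAtInfinity f).coeff (i - k) := by
  rw [map_mul, expandAtInfinity_delay, HahnSeries.coeff_single_mul, one_mul]

theorem coeff_expandAtInfinity_delay_C (k : ℕ) (c : ℝ) (i : ℤ) :
    (expandAtInfinity (delay k * RatFunc.C c)).coeff i = if i = k then c else 0 := by
  rw [coeff_expandAtInfinity_delay_mul, expandAtInfinity_C, HahnSeries.C_apply,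
    HahnSeries.coeff_single]
  simp [sub_eq_zero]

/-! ### Matrices with entries in a subring -/

/-- All entries lie in the subring `S`. -/
def EntriesIn (S : Subring (RatFunc ℝ)) {ι κ : Type*} (F : Matrix ι κ (RatFunc ℝ)) : Prop :=
  ∀ i j, F i j ∈ S

namespace EntriesIn

variable {S : Subring (RatFunc ℝ)} {ι κ μ : Type*}

theorem mul [Fintype κ] {F : Matrix ι κ (RatFunc ℝ)} {H : Matrix κ μ (RatFunc ℝ)}
    (hF : EntriesIn S F) (hH : EntriesIn S H) : EntriesIn S (F * H) := fun i j => by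
  rw [Matrix.mul_apply]
  exact sum_mem fun k _ => mul_mem (hF i k) (hH k j)

theorem add {F H : Matrix ι κ (RatFunc ℝ)} (hF : EntriesIn S F) (hH : EntriesIn S H) :
    EntriesIn S (F + H) := fun i j => add_mem (hF i j) (hH i j)

theorem sub {F H : Matrix ι κ (RatFunc ℝ)} (hF : EntriesIn S F) (hH : EntriesIn S H) :
    EntriesIn S (F - H) := fun i j => sub_mem (hF i j) (hH i j)

theorem neg {F : Matrix ι κ (RatFunc ℝ)} (hF : EntriesIn S F) : EntriesIn S (-F) :=
  fun i j => neg_mem (hF i j)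

theorem zero : EntriesIn S (0 : Matrix ι κ (RatFunc ℝ)) := fun _ _ => zero_mem S

theorem one [DecidableEq ι] : EntriesIn S (1 : Matrix ι ι (RatFunc ℝ)) := fun i j => by
  rw [Matrix.one_apply]
  split_ifs
  exacts [one_mem S, zero_mem S]

theorem smul {c : RatFunc ℝ} (hc : c ∈ S) {F : Matrix ι κ (RatFunc ℝ)} (hF : EntriesIn S F) :
    EntriesIn S (c • F) := fun i j => mul_mem hc (hF i j)

theorem sum {α : Type*} {s : Finset α} {F : α → Matrix ι κ (RatFunc ℝ)}
    (hF : ∀ a ∈ s, EntriesIn S (F a)) : EntriesIn S (∑ a ∈ s, F a) := fun i j => by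
  rw [Matrix.sum_apply]
  exact sum_mem fun a ha => hF a ha i j

theorem mono {T : Subring (RatFunc ℝ)} (h : S ≤ T) {F : Matrix ι κ (RatFunc ℝ)}
    (hF : EntriesIn S F) : EntriesIn T F := fun i j => h (hF i j)

theorem fromBlocks {ν : Type*} {A : Matrix ι κ (RatFunc ℝ)} {B : Matrix ι μ (RatFunc ℝ)}
    {C : Matrix ν κ (RatFunc ℝ)} {D : Matrix ν μ (RatFunc ℝ)} (hA : EntriesIn S A)
    (hB : EntriesIn S B) (hC : EntriesIn S C) (hD : EntriesIn S D) :
    EntriesIn S (Matrix.fromBlocks A B C D) := by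
  rintro (i | i) (j | j)
  exacts [hA i j, hB i j, hC i j, hD i j]

end EntriesIn

theorem const_stable {a b : ℕ} (M : Matrix (Fin a) (Fin b) ℝ) :
    EntriesIn stableSubring (const M) := fun _ _ => stableEntry_C _

/-- A perturbation of the identity by a strictly proper matrix has a proper inverse. -/
theorem one_add_strictly_proper_matrix {ι : Type*} [Fintype ι] [DecidableEq ι]
    {B : Matrix ι ι (RatFunc ℝ)} (hB : EntriesIn properSubring B) :
    IsUnit (1 + (RatFunc.X : RatFunc ℝ)⁻¹ • B).det ∧
      EntriesIn properSubring (1 + (RatFunc.X : RatFunc ℝ)⁻¹ • B)⁻¹ := by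
  -- Work over the ring of proper functions: once the determinant is a unit there, the inverse
  -- automatically has proper entries.
  let r : properSubring := ⟨(RatFunc.X)⁻¹, stableSubring_le X_inv_stable⟩
  let B' : Matrix ι ι properSubring := Matrix.of fun i j => ⟨B i j, hB i j⟩
  set A' : Matrix ι ι properSubring := 1 + r • B' with hA'
  set A : Matrix ι ι (RatFunc ℝ) := 1 + (RatFunc.X : RatFunc ℝ)⁻¹ • B with hA
  have hAA : properSubring.subtype.mapMatrix A' = A := by
    rw [hA', map_add, map_one]
    rfl
  have hdet : IsUnit A'.det := by
    -- The determinant is 1 modulo r, which reduces the claim to the scalar case.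
    obtain ⟨s, hs⟩ : ∃ s, A'.det = 1 + r * s :=
      ⟨Matrix.trace B' + ((1 + (Polynomial.X : Polynomial properSubring) •
        B'.map Polynomial.C).det).divX.divX.eval r * r, by rw [Matrix.det_one_add_smul]; ring⟩
    obtain ⟨h0, hinv⟩ := one_add_strictly_proper s.2
    rw [hs]
    refine IsUnit.of_mul_eq_one ⟨_, hinv⟩ (Subtype.ext ?_)
    exact mul_inv_cancel₀ h0
  have h1 : A * properSubring.subtype.mapMatrix A'⁻¹ = 1 := by
    rw [← hAA, ← map_mul, Matrix.mul_nonsing_inv _ hdet, map_one]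
  refine ⟨?_, ?_⟩
  · rw [← hAA, ← RingHom.map_det]
    exact hdet.map _
  · rw [Matrix.inv_eq_right_inv h1]
    exact fun i j => (A'⁻¹ i j).2

/-! ### Resolvents -/

section Resolvent

variable {n : ℕ} (A : Matrix (Fin n) (Fin n) ℝ)

theorem smul_one_sub_const_eq :
    (RatFunc.X : RatFunc ℝ) • (1 : TransferMatrix n n) - const A =
      (RatFunc.X : RatFunc ℝ) • (1 + (RatFunc.X : RatFunc ℝ)⁻¹ • (-const A)) := by
  rw [smul_add, smul_smul, mul_inv_cancel₀ RatFunc.X_ne_zero, one_smul, sub_eq_add_neg]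

theorem isUnit_det_smul_one_sub_const :
    IsUnit ((RatFunc.X : RatFunc ℝ) • (1 : TransferMatrix n n) - const A).det := by
  rw [smul_one_sub_const_eq, Matrix.det_smul]
  exact (IsUnit.mk0 _ (pow_ne_zero _ RatFunc.X_ne_zero)).mul
    (one_add_strictly_proper_matrix ((const_stable A).mono stableSubring_le).neg).1

theorem exists_resolvent_eq :
    ∃ R : TransferMatrix n n, EntriesIn properSubring R ∧
      ((RatFunc.X : RatFunc ℝ) • (1 : TransferMatrix n n) - const A)⁻¹ =
        (RatFunc.X : RatFunc ℝ)⁻¹ • R := by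
  obtain ⟨hu, hp⟩ :=
    one_add_strictly_proper_matrix ((const_stable A).mono stableSubring_le).neg
  refine ⟨_, hp, Matrix.inv_eq_right_inv ?_⟩
  rw [smul_one_sub_const_eq, Matrix.smul_mul, Matrix.mul_smul, smul_smul,
    mul_inv_cancel₀ RatFunc.X_ne_zero, one_smul, Matrix.mul_nonsing_inv _ hu]

/-- By the adjugate formula, the denominator of each entry divides the characteristic polynomial,
whose complex roots are the eigenvalues. -/
theorem resolvent_stable (hA : IsSchur A) :
    EntriesIn stableSubring ((RatFunc.X : RatFunc ℝ) • (1 : TransferMatrix n n) - const A)⁻¹ := by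
  intro i j
  have hproper :
      ((RatFunc.X : RatFunc ℝ) • (1 : TransferMatrix n n) - const A)⁻¹ i j ∈ properSubring := by
    obtain ⟨R, hR, h⟩ := exists_resolvent_eq A
    rw [h]
    exact hR.smul (stableSubring_le X_inv_stable) i j
  have hchar : (RatFunc.X : RatFunc ℝ) • (1 : TransferMatrix n n) - const A =
      (algebraMap ℝ[X] (RatFunc ℝ)).mapMatrix A.charmatrix := by
    ext k l
    by_cases hkl : k = l
    · subst hkl
      simp [const]
    · simp [const, hkl]
  have hdenom : (((RatFunc.X : RatFunc ℝ) • (1 : TransferMatrix n n) - const A)⁻¹ i j).denom ∣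
      A.charpoly := by
    rw [hchar, Matrix.inv_def, ← RingHom.map_adjugate, ← RingHom.map_det, Ring.inverse_eq_inv',
      Matrix.smul_apply, smul_eq_mul, mul_comm, ← div_eq_mul_inv]
    exact RatFunc.denom_div_dvd _ _
  refine StableEntry.of_denom_dvd hproper hdenom fun w hw => hA w ?_
  rw [Matrix.mem_spectrum_iff_isRoot_charpoly]
  have : A.map ((↑) : ℝ → ℂ) = A.map (algebraMap ℝ ℂ) := rfl
  rw [this, Matrix.charpoly_map, Polynomial.IsRoot.def, Polynomial.eval_map_algebraMap]
  exact hw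

end Resolvent

/-! ### Power series coefficients and the orthogonal projection -/

section Projection

variable {a b : ℕ}

theorem const_zero : const (0 : Matrix (Fin a) (Fin b) ℝ) = 0 := by ext; simp [const]

theorem const_add (V W : Matrix (Fin a) (Fin b) ℝ) : const (V + W) = const V + const W := by
  ext; simp [const]

theorem const_mul {c : ℕ} (V : Matrix (Fin a) (Fin b) ℝ) (W : Matrix (Fin b) (Fin c) ℝ) :
    const (V * W) = const V * const W := Matrix.map_mul

/-- The first `m` terms of the power series in `1 / z` of a proper matrix. -/
theorem exists_eq_sum_add_delay {F : TransferMatrix a b} (hF : EntriesIn properSubring F)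
    (m : ℕ) :
    ∃ (V : ℕ → Matrix (Fin a) (Fin b) ℝ) (R : TransferMatrix a b), EntriesIn properSubring R ∧
      (EntriesIn stableSubring F → EntriesIn stableSubring R) ∧
      F = ∑ i ∈ Finset.range m, delay i • const (V i) + delay m • R := by
  induction m with
  | zero => exact ⟨0, F, hF, id, by simp [delay_zero]⟩
  | succ m ih =>
    obtain ⟨V, R, hR, hRs, h⟩ := ih
    -- Peel the value at infinity off each entry of the remainder; what is left carries one more
    -- delay.
    choose c g hg hgs hcg using fun i j => exists_eq_C_add (hR i j)
    refine ⟨Function.update V m (Matrix.of c), Matrix.of g, hg,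
      fun hs i j => hgs i j (hRs hs i j), ?_⟩
    have hRe : R = const (Matrix.of c) + delay 1 • Matrix.of g := by
      ext i j
      simpa [const, delay] using hcg i j
    rw [Finset.sum_range_succ, Function.update_self, h, add_assoc, ← delay_mul, mul_smul,
      ← smul_add, ← hRe]
    congr 1
    refine Finset.sum_congr rfl fun i hi => ?_
    rw [Function.update_of_ne (Finset.mem_range.1 hi).ne]

theorem coeff_sum_add_delay (s : Finset ℕ) (V : ℕ → Matrix (Fin a) (Fin b) ℝ) {m : ℕ}
    {R : TransferMatrix a b} (hR : EntriesIn properSubring R) {i : ℕ} (hi : i < m) (r : Fin a)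
    (t : Fin b) :
    (expandAtInfinity ((∑ k ∈ s, delay k • const (V k) + delay m • R) r t)).coeff (i : ℤ) =
      if i ∈ s then V i r t else 0 := by
  rw [Matrix.add_apply, Matrix.sum_apply, map_add, map_sum, HahnSeries.coeff_add,
    HahnSeries.coeff_sum, Matrix.smul_apply, smul_eq_mul, coeff_expandAtInfinity_delay_mul,
    coeff_expandAtInfinity_of_neg (hR r t) (by omega), add_zero]
  simp only [Matrix.smul_apply, smul_eq_mul, const, Matrix.map_apply,
    coeff_expandAtInfinity_delay_C, Nat.cast_inj, Finset.sum_ite_eq]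

open scoped ComplexOrder in
-- Testing against D i placed at the single index i gives the squared Frobenius norm of D i. All
-- sums have finite support, so convergence plays no role.
theorem htwoInner_Xp_eq_zero_iff {N : ℕ} {D : ℕ → Matrix (Fin a) (Fin b) ℂ} :
    (∀ W ∈ Xp N a b, htwoInner D W = 0) ↔ ∀ i ≤ N, D i = 0 := by
  constructor
  · intro h i hi
    have h1 := h (Function.update 0 i (D i)) (fun j hj => by
      rw [Function.update_of_ne (by omega)]; rfl)
    rw [htwoInner, tsum_eq_single i (fun j hj => by
      rw [Function.update_of_ne hj]; simp), Function.update_self] at h1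
    exact Matrix.trace_mul_conjTranspose_self_eq_zero_iff.1 h1
  · intro h W hW
    rw [htwoInner]
    refine (tsum_congr fun i => ?_).trans tsum_zero
    by_cases hi : i ≤ N
    · rw [h i hi]; simp
    · rw [hW i (by omega)]; simp

theorem YSpace.proper {N : ℕ} {pat : ℕ → Fin a → Fin b → Prop} {F : TransferMatrix a b}
    (hF : F ∈ YSpace N pat) : EntriesIn properSubring F := by
  obtain ⟨V, -, rfl⟩ := hF
  exact (EntriesIn.sum fun i _ => (const_stable _).smul (delay_stable i)).mono stableSubring_le

theorem SSpace.proper {N : ℕ} {pat : ℕ → Fin a → Fin b → Prop} {F : TransferMatrix a b}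
    (hF : F ∈ SSpace N pat) : EntriesIn properSubring F := by
  obtain ⟨H, hH, _, ⟨R, hR, rfl⟩, rfl⟩ := hF
  exact (YSpace.proper hH).add (EntriesIn.smul (stableSubring_le (delay_stable _)) hR)

/-- A proper matrix lies in `S` if and only if its projection onto the FIR matrices lies in `Y`. -/
theorem mem_SSpace_iff_projection {N : ℕ} {pat : ℕ → Fin a → Fin b → Prop}
    {F : TransferMatrix a b} (hF : EntriesIn properSubring F) :
    F ∈ SSpace N pat ↔ ∃ P ∈ YSpace N pat, IsXpProjection N F P := by
  constructor
  · rintro ⟨H, hH, _, ⟨R, hR, rfl⟩, rfl⟩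
    refine ⟨H, hH, YSpace.proper hH, ?_, ?_⟩
    · obtain ⟨V, hV, rfl⟩ := hH
      intro i hi
      ext r t
      -- A zero tail delayed beyond i makes the coefficient formula applicable at an index i > N.
      have h := coeff_sum_add_delay (Finset.Icc 1 N) V (m := i + 1) (R := 0) EntriesIn.zero
        (Nat.lt_succ_self i) r t
      rw [if_neg (by simp; omega), smul_zero, add_zero] at h
      simp [coeffs, h]
    · rw [htwoInner_Xp_eq_zero_iff]
      intro i hi
      ext r t
      simp only [coeffs, Pi.sub_apply, Matrix.sub_apply, Matrix.of_apply, Matrix.add_apply,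
        Matrix.smul_apply, smul_eq_mul, map_add, HahnSeries.coeff_add,
        coeff_expandAtInfinity_delay_mul, Matrix.zero_apply]
      rw [coeff_expandAtInfinity_of_neg (hR r t) (by omega), add_zero, sub_self]
  · rintro ⟨P, hP, hPp, -, hproj⟩
    rw [htwoInner_Xp_eq_zero_iff] at hproj
    refine ⟨P, hP, F - P, ?_, by abel⟩
    -- Orthogonality kills the coefficients of F - P of index 0 to N. These are the first N + 1
    -- terms, so only the delayed remainder survives.
    obtain ⟨V, R, hR, -, hV⟩ := exists_eq_sum_add_delay (hF.sub hPp) (N + 1)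
    refine ⟨R, hR, ?_⟩
    have hzero : ∀ i ∈ Finset.range (N + 1), V i = 0 := by
      intro i hi
      ext r t
      have h := coeff_sum_add_delay (Finset.range (N + 1)) V hR (Finset.mem_range.1 hi) r t
      rw [← hV, if_pos hi, Matrix.sub_apply, map_sub, HahnSeries.coeff_sub] at h
      have h2 := congrFun (congrFun (hproj i (Finset.mem_range_succ_iff.1 hi)) r) t
      simp only [coeffs, Pi.sub_apply, Matrix.sub_apply, Matrix.of_apply, Matrix.zero_apply] at h2
      rw [← h]
      exact_mod_cast h2
    rw [hV, Finset.sum_eq_zero, zero_add]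
    intro i hi
    rw [hzero i hi, const_zero, smul_zero]

end Projection

/-! ### Quadratic invariance -/

section QuadraticInvariance

variable {a b N : ℕ} {pat : ℕ → Fin a → Fin b → Prop}

theorem SSpace.add {F H : TransferMatrix a b} (hF : F ∈ SSpace N pat) (hH : H ∈ SSpace N pat) :
    F + H ∈ SSpace N pat := by
  obtain ⟨_, ⟨V, hV, rfl⟩, _, ⟨R, hR, rfl⟩, rfl⟩ := hF
  obtain ⟨_, ⟨V', hV', rfl⟩, _, ⟨R', hR', rfl⟩, rfl⟩ := hH
  refine ⟨_, ⟨V + V', fun i hi r t h => ?_, rfl⟩, _, ⟨R + R', EntriesIn.add (S := properSubring) hR hR', rfl⟩, ?_⟩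
  · simp [hV i hi r t h, hV' i hi r t h]
  · simp only [Pi.add_apply, const_add, smul_add, Finset.sum_add_distrib]
    abel

theorem SSpace.smul {F : TransferMatrix a b} (c : ℝ) (hF : F ∈ SSpace N pat) :
    RatFunc.C c • F ∈ SSpace N pat := by
  obtain ⟨_, ⟨V, hV, rfl⟩, _, ⟨R, hR, rfl⟩, rfl⟩ := hF
  refine ⟨_, ⟨fun i => c • V i, fun i hi r t h => ?_, rfl⟩, _,
    ⟨RatFunc.C c • R, EntriesIn.smul (S := properSubring) (properEntry_C c) hR, rfl⟩, ?_⟩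
  · simp [hV i hi r t h]
  · rw [smul_add, Finset.smul_sum, smul_comm (RatFunc.C c)]
    congr 1
    refine Finset.sum_congr rfl fun i _ => ?_
    rw [smul_comm]
    congr 1
    ext r t
    simp [const]

theorem SSpace.neg {F : TransferMatrix a b} (hF : F ∈ SSpace N pat) : -F ∈ SSpace N pat := by
  simpa using SSpace.smul (-1) hF

theorem YSpace.zero_mem : (0 : TransferMatrix a b) ∈ YSpace N pat :=
  ⟨0, fun _ _ _ _ _ => rfl, by simp [const_zero]⟩

theorem SSpace.delay_smul_mem {R : TransferMatrix a b} (hR : EntriesIn properSubring R) :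
    delay (N + 1) • R ∈ SSpace N pat :=
  ⟨0, YSpace.zero_mem, _, ⟨R, hR, rfl⟩, (zero_add _).symm⟩

theorem SSpace.zero_mem : (0 : TransferMatrix a b) ∈ SSpace N pat := by
  simpa using SSpace.delay_smul_mem (N := N) (pat := pat) (R := 0) EntriesIn.zero

theorem QuadraticallyInvariant.neg {G : TransferMatrix b a}
    (h : QuadraticallyInvariant (SSpace N pat) G) :
    QuadraticallyInvariant (SSpace N pat) (-G) := by
  intro K hK
  simpa using SSpace.neg (h K hK)

/-- Polarization: apply invariance to K + K (G K)^i and remove the two squares. Both cross terms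
equal K (G K)^(i+1), and the resulting factor 2 is divided out. -/
theorem QuadraticallyInvariant.mul_pow_mem {G : TransferMatrix b a}
    (h : QuadraticallyInvariant (SSpace N pat) G) {K : TransferMatrix a b}
    (hK : K ∈ SSpace N pat) (i : ℕ) : K * (G * K) ^ i ∈ SSpace N pat := by
  induction i with
  | zero => simpa using hK
  | succ i ih =>
    have h1 := h _ (SSpace.add hK ih)
    have h2 := SSpace.smul (1 / 2) (SSpace.add h1 (SSpace.neg (SSpace.add (h K hK) (h _ ih))))
    have hpow : K * (G * K) ^ i * G * K = K * (G * K) ^ (i + 1) := by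
      rw [pow_succ]; simp only [Matrix.mul_assoc]
    have hpow' : K * G * (K * (G * K) ^ i) = K * (G * K) ^ (i + 1) := by
      rw [pow_succ']; simp only [Matrix.mul_assoc]
    have h3 : (K + K * (G * K) ^ i) * G * (K + K * (G * K) ^ i) +
        -(K * G * K + K * (G * K) ^ i * G * (K * (G * K) ^ i)) =
        K * (G * K) ^ (i + 1) + K * (G * K) ^ (i + 1) := by
      rw [Matrix.add_mul, Matrix.add_mul, Matrix.mul_add, Matrix.mul_add, hpow, hpow']
      abel
    rw [h3] at h2
    convert h2 using 1
    rw [← two_smul (RatFunc ℝ), smul_smul]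
    have : RatFunc.C (1 / 2 : ℝ) * 2 = 1 := by
      rw [← map_ofNat (RatFunc.C (K := ℝ)) 2, ← map_mul]
      norm_num
    rw [this, one_smul]

/-- The closed-loop map `J = K (1 - G K)⁻¹` of a controller in a quadratically invariant `S` lies
in `S`. -/
theorem QuadraticallyInvariant.closedLoop_mem {G' : TransferMatrix b a}
    (hG' : EntriesIn properSubring G')
    (h : QuadraticallyInvariant (SSpace N pat) ((RatFunc.X : RatFunc ℝ)⁻¹ • G'))
    {K J : TransferMatrix a b} (hK : K ∈ SSpace N pat) (hJ : EntriesIn properSubring J)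
    (hJK : J = K + J * ((RatFunc.X : RatFunc ℝ)⁻¹ • G') * K) : J ∈ SSpace N pat := by
  set G := (RatFunc.X : RatFunc ℝ)⁻¹ • G' with hG
  -- Iterating the fixed-point equation gives a truncated geometric series with exact remainder, so
  -- no infinite sum is needed.
  have hsum : ∀ m : ℕ, J = ∑ i ∈ Finset.range m, K * (G * K) ^ i + J * (G * K) ^ m := by
    intro m
    induction m with
    | zero => simp
    | succ m ih =>
      rw [Finset.sum_range_succ, add_assoc, pow_succ', ← Matrix.mul_assoc, ← Matrix.add_mul,
        ← Matrix.mul_assoc, ← hJK]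
      exact ih
  rw [hsum (N + 1)]
  refine SSpace.add ?_ ?_
  · refine Finset.sum_induction _ (· ∈ SSpace N pat) (fun _ _ => SSpace.add) SSpace.zero_mem ?_
    exact fun i _ => h.mul_pow_mem hK i
  -- Each factor G K supplies one delay, so the remainder has N + 1 of them.
  · rw [hG, Matrix.smul_mul, smul_pow, Matrix.mul_smul]
    refine SSpace.delay_smul_mem (hJ.mul ?_)
    have hGK : EntriesIn properSubring (G' * K) := hG'.mul (SSpace.proper hK)
    induction N + 1 with
    | zero => simpa using EntriesIn.one
    | succ m ih => rw [pow_succ]; exact ih.mul hGK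

end QuadraticInvariance

/-! ### Internal stability and the Youla parametrization -/

section Youla

variable {p q : ℕ} {G : TransferMatrix q p} {K : TransferMatrix p q}

/-- The blocks of the inverse of the loop operator, and the loop equations they satisfy. -/
theorem InternallyStabilizes.exists_blocks (hu : IsUnit (loop G K).det)
    (hs : Stable (loop G K)⁻¹) :
    ∃ (H₁₁ : TransferMatrix p p) (H₁₂ : TransferMatrix p q) (H₂₁ : TransferMatrix q p)
      (H₂₂ : TransferMatrix q q),
      (loop G K)⁻¹ = Matrix.fromBlocks H₁₁ H₁₂ H₂₁ H₂₂ ∧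
      EntriesIn stableSubring H₁₁ ∧ EntriesIn stableSubring H₁₂ ∧
      EntriesIn stableSubring H₂₁ ∧ EntriesIn stableSubring H₂₂ ∧
      H₁₁ - H₁₂ * G = 1 ∧ H₁₂ = H₁₁ * K ∧ H₂₁ = H₂₂ * G ∧
      H₂₁ = G * H₁₁ ∧ H₂₂ - G * H₁₂ = 1 := by
  have hl := Matrix.nonsing_inv_mul _ hu
  have hr := Matrix.mul_nonsing_inv _ hu
  have hb := (Matrix.fromBlocks_toBlocks (loop G K)⁻¹).symm
  refine ⟨_, _, _, _, hb, fun i j => hs _ _, fun i j => hs _ _, fun i j => hs _ _,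
    fun i j => hs _ _, ?_⟩
  rw [hb, loop, Matrix.fromBlocks_multiply, ← Matrix.fromBlocks_one, Matrix.fromBlocks_inj]
    at hl hr
  simp only [Matrix.mul_neg, Matrix.neg_mul, Matrix.mul_one, Matrix.one_mul] at hl hr
  obtain ⟨l1, l2, l3, l4⟩ := hl
  obtain ⟨r1, r2, r3, r4⟩ := hr
  refine ⟨by rw [sub_eq_add_neg]; exact l1, ?_, ?_, ?_, ?_⟩
  · exact (neg_add_eq_zero.1 l2).symm
  · rwa [← sub_eq_add_neg, sub_eq_zero] at l3
  · exact (neg_add_eq_zero.1 r3).symm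
  · rw [sub_eq_add_neg, add_comm]
    exact r4

variable {Mh : TransferMatrix p p} {Nh : TransferMatrix q p}
  {Xh : TransferMatrix q q} {Yh : TransferMatrix p q} {Mt : TransferMatrix q q}
  {Nt : TransferMatrix q p} {Xt : TransferMatrix p p} {Yt : TransferMatrix p q}

namespace IsDoublyCoprimeFactorization

theorem bezout_left (h : IsDoublyCoprimeFactorization G Mh Nh Xh Yh Mt Nt Xt Yt) :
    Xt * Mh - Yt * Nh = 1 := by
  have hb := h.bezout
  rw [Matrix.fromBlocks_multiply, ← Matrix.fromBlocks_one, Matrix.fromBlocks_inj] at hb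
  simpa [sub_eq_add_neg] using hb.1

/-- A left inverse of a square matrix is a right inverse, so the Bezout identity also holds in the
opposite order. -/
theorem bezout_right (h : IsDoublyCoprimeFactorization G Mh Nh Xh Yh Mt Nt Xt Yt) :
    Yh * Mt = Mh * Yt ∧ Xh * Mt - Nh * Yt = 1 := by
  have hb := mul_eq_one_comm.1 h.bezout
  rw [Matrix.fromBlocks_multiply, ← Matrix.fromBlocks_one, Matrix.fromBlocks_inj] at hb
  simp only [Matrix.mul_neg] at hb
  exact ⟨(neg_add_eq_zero.1 hb.2.1).symm, by rw [← hb.2.2.2]; abel⟩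

theorem mul_Mh (h : IsDoublyCoprimeFactorization G Mh Nh Xh Yh Mt Nt Xt Yt) : G * Mh = Nh := by
  rw [h.right_fact, Matrix.mul_assoc, Matrix.nonsing_inv_mul _ h.Mh_unit, Matrix.mul_one]

theorem numerator_mul_Mt (h : IsDoublyCoprimeFactorization G Mh Nh Xh Yh Mt Nt Xt Yt)
    (Q : TransferMatrix p q) : (Yh - Mh * Q) * Mt = Mh * (Yt - Q * Mt) := by
  rw [Matrix.sub_mul, h.bezout_right.1, Matrix.mul_sub, Matrix.mul_assoc]

theorem denominator_mul_Mt (h : IsDoublyCoprimeFactorization G Mh Nh Xh Yh Mt Nt Xt Yt)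
    (Q : TransferMatrix p q) : (Xh - Nh * Q) * Mt = 1 + G * ((Yh - Mh * Q) * Mt) := by
  rw [h.numerator_mul_Mt, ← Matrix.mul_assoc, h.mul_Mh, Matrix.sub_mul, ← h.bezout_right.2,
    Matrix.mul_sub, Matrix.mul_assoc]
  abel

theorem numerator_stable (h : IsDoublyCoprimeFactorization G Mh Nh Xh Yh Mt Nt Xt Yt)
    {Q : TransferMatrix p q} (hQ : EntriesIn stableSubring Q) :
    EntriesIn stableSubring (Yh - Mh * Q) :=
  EntriesIn.sub (S := stableSubring) h.Yh_stable (EntriesIn.mul (S := stableSubring) h.Mh_stable hQ)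

theorem denominator_stable (h : IsDoublyCoprimeFactorization G Mh Nh Xh Yh Mt Nt Xt Yt)
    {Q : TransferMatrix p q} (hQ : EntriesIn stableSubring Q) :
    EntriesIn stableSubring (Xh - Nh * Q) :=
  EntriesIn.sub (S := stableSubring) h.Xh_stable (EntriesIn.mul (S := stableSubring) h.Nh_stable hQ)

theorem closedLoop_stable (h : IsDoublyCoprimeFactorization G Mh Nh Xh Yh Mt Nt Xt Yt)
    {Q : TransferMatrix p q} (hQ : EntriesIn stableSubring Q) :
    EntriesIn stableSubring ((Yh - Mh * Q) * Mt) :=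
  (h.numerator_stable hQ).mul h.Mt_stable

variable {G' : TransferMatrix q p}

/-- By `denominator_mul_Mt`, multiplying by Mt turns the denominator into the identity plus a
strictly proper matrix. -/
theorem denominator_isUnit
    (h : IsDoublyCoprimeFactorization G Mh Nh Xh Yh Mt Nt Xt Yt)
    (hG' : EntriesIn properSubring G') (hG : G = (RatFunc.X : RatFunc ℝ)⁻¹ • G')
    {Q : TransferMatrix p q} (hQ : EntriesIn stableSubring Q) :
    IsUnit (Xh - Nh * Q).det ∧ EntriesIn properSubring ((Xh - Nh * Q) * Mt)⁻¹ := by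
  have hY : EntriesIn stableSubring ((Yh - Mh * Q) * Mt) :=
    h.closedLoop_stable hQ
  have hX := h.denominator_mul_Mt Q
  obtain ⟨hu, hp⟩ := one_add_strictly_proper_matrix (hG'.mul (hY.mono stableSubring_le))
  rw [← Matrix.smul_mul, ← hG, ← hX] at hu hp
  refine ⟨?_, hp⟩
  rw [Matrix.det_mul] at hu
  exact isUnit_of_mul_isUnit_left hu

/-- Solving the fraction for Q gives Mh Q = H₁₁ (Yh - K Xh), where H₁₁ = (1 - K G)⁻¹. Stability of Q
is then the point to check. -/
theorem exists_parameter
    (h : IsDoublyCoprimeFactorization G Mh Nh Xh Yh Mt Nt Xt Yt)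
    (hG' : EntriesIn properSubring G') (hG : G = (RatFunc.X : RatFunc ℝ)⁻¹ • G')
    (hK : InternallyStabilizes G K) :
    ∃ Q : TransferMatrix p q, EntriesIn stableSubring Q ∧ K = (Yh - Mh * Q) * (Xh - Nh * Q)⁻¹ := by
  obtain ⟨H₁₁, H₁₂, H₂₁, H₂₂, -, s11, s12, s21, s22, e1, e2, -, e4, e5⟩ :=
    InternallyStabilizes.exists_blocks hK.1 hK.2
  set Q : TransferMatrix p q := (Xt - Yt * G) * (H₁₁ * Yh - H₁₂ * Xh) with hQdef
  have hQ : EntriesIn stableSubring Q := by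
    -- The possibly unstable G is absorbed by the loop equations G H₁₁ = H₂₁ and G H₁₂ = H₂₂ - 1.
    have hQ' : Q = Xt * (H₁₁ * Yh - H₁₂ * Xh) - Yt * (H₂₁ * Yh - (H₂₂ - 1) * Xh) := by
      have : H₂₂ - 1 = G * H₁₂ := by rw [← e5]; abel
      rw [this, e4, hQdef, Matrix.sub_mul]
      simp only [Matrix.mul_sub, Matrix.mul_assoc]
    rw [hQ']
    exact (EntriesIn.mul (S := stableSubring) h.Xt_stable
      ((s11.mul h.Yh_stable).sub (s12.mul h.Xh_stable))).sub
      (EntriesIn.mul (S := stableSubring) h.Yt_stable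
        ((s21.mul h.Yh_stable).sub ((s22.sub EntriesIn.one).mul h.Xh_stable)))
  refine ⟨Q, hQ, ?_⟩
  have hMQ : Mh * Q = H₁₁ * (Yh - K * Xh) := by
    -- The Bezout identity and G Mh = Nh identify Xt - Yt G as the inverse of Mh.
    have h1 : Mh * (Xt - Yt * G) = 1 := by
      rw [mul_eq_one_comm, Matrix.sub_mul, Matrix.mul_assoc, h.mul_Mh, h.bezout_left]
    rw [hQdef, ← Matrix.mul_assoc, h1, Matrix.one_mul, e2, Matrix.mul_sub, Matrix.mul_assoc]
  have hloop : (1 - K * G) * H₁₁ = 1 := by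
    rw [mul_eq_one_comm, Matrix.mul_sub, Matrix.mul_one, ← Matrix.mul_assoc, ← e2, e1]
  have hKX : K * (Xh - Nh * Q) = Yh - Mh * Q := by
    have h1 : (1 - K * G) * (Mh * Q) = Yh - K * Xh := by
      rw [hMQ, ← Matrix.mul_assoc, hloop, Matrix.one_mul]
    rw [Matrix.sub_mul, Matrix.one_mul, Matrix.mul_assoc, ← Matrix.mul_assoc G, h.mul_Mh] at h1
    rw [Matrix.mul_sub, sub_eq_sub_iff_add_eq_add]
    rw [sub_eq_sub_iff_add_eq_add] at h1
    rw [add_comm, h1]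
  rw [← hKX, Matrix.mul_nonsing_inv_cancel_right _ _ (h.denominator_isUnit hG' hG hQ).1]

/-- The inverse of the loop operator can be written in closed form, with blocks built only from Q
and the stable coprime factors. -/
theorem internallyStabilizes
    (h : IsDoublyCoprimeFactorization G Mh Nh Xh Yh Mt Nt Xt Yt)
    (hG' : EntriesIn properSubring G') (hG : G = (RatFunc.X : RatFunc ℝ)⁻¹ • G')
    {Q : TransferMatrix p q} (hQ : EntriesIn stableSubring Q)
    (hK : K = (Yh - Mh * Q) * (Xh - Nh * Q)⁻¹) : InternallyStabilizes G K := by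
  have hu := (h.denominator_isUnit hG' hG hQ).1
  have hKX : K * (Xh - Nh * Q) = Yh - Mh * Q := by
    rw [hK, Matrix.nonsing_inv_mul_cancel_right _ _ hu]
  have hKJ : K * ((Xh - Nh * Q) * Mt) = (Yh - Mh * Q) * Mt := by rw [← Matrix.mul_assoc, hKX]
  have hXJ := h.denominator_mul_Mt Q
  have hYJ : EntriesIn stableSubring (Yh - Mh * Q) :=
    h.numerator_stable hQ
  have hXs : EntriesIn stableSubring (Xh - Nh * Q) :=
    h.denominator_stable hQ
  have hNt : Mt * G = Nt := by
    rw [h.left_fact, Matrix.mul_nonsing_inv_cancel_left _ _ h.Mt_unit]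
  have hinv : loop G K * Matrix.fromBlocks (1 + (Yh - Mh * Q) * Nt) ((Yh - Mh * Q) * Mt)
      ((Xh - Nh * Q) * Nt) ((Xh - Nh * Q) * Mt) = 1 := by
    rw [loop, Matrix.fromBlocks_multiply, ← Matrix.fromBlocks_one, Matrix.fromBlocks_inj]
    simp only [Matrix.neg_mul, Matrix.one_mul]
    refine ⟨?_, ?_, ?_, ?_⟩
    · rw [← Matrix.mul_assoc, hKX]; abel
    · rw [hKJ]; abel
    · rw [← hNt, ← Matrix.mul_assoc (Xh - Nh * Q), hXJ, ← Matrix.mul_assoc (Yh - Mh * Q),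
        Matrix.mul_add, Matrix.mul_one, Matrix.add_mul, Matrix.one_mul, ← Matrix.mul_assoc G]
      abel
    · rw [hXJ]; abel
  refine ⟨?_, ?_⟩
  · exact (Matrix.isUnit_iff_isUnit_det _).1 (IsUnit.of_mul_eq_one _ hinv)
  · rw [Matrix.inv_eq_right_inv hinv]
    exact (EntriesIn.one.add (hYJ.mul h.Nt_stable)).fromBlocks (hYJ.mul h.Mt_stable)
      (hXs.mul h.Nt_stable) (hXs.mul h.Mt_stable)

/-- Under quadratic invariance, membership of the controller in `S` is membership of the
closed-loop map from `v₂` to `u`. -/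
theorem mem_SSpace_iff {N : ℕ} {pat : ℕ → Fin p → Fin q → Prop}
    (h : IsDoublyCoprimeFactorization G Mh Nh Xh Yh Mt Nt Xt Yt)
    (hG' : EntriesIn properSubring G') (hG : G = (RatFunc.X : RatFunc ℝ)⁻¹ • G')
    (hQI : QuadraticallyInvariant (SSpace N pat) G)
    {Q : TransferMatrix p q} (hQ : EntriesIn stableSubring Q)
    (hK : K = (Yh - Mh * Q) * (Xh - Nh * Q)⁻¹) :
    K ∈ SSpace N pat ↔ (Yh - Mh * Q) * Mt ∈ SSpace N pat := by
  obtain ⟨hu, hp⟩ := h.denominator_isUnit hG' hG hQ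
  set J := (Yh - Mh * Q) * Mt with hJdef
  have hJs : EntriesIn properSubring J := (h.closedLoop_stable hQ).mono stableSubring_le
  have hKJ : K * ((Xh - Nh * Q) * Mt) = J := by
    rw [hK, ← Matrix.mul_assoc, Matrix.nonsing_inv_mul_cancel_right _ _ hu]
  have huX : IsUnit ((Xh - Nh * Q) * Mt).det := by
    rw [Matrix.det_mul]; exact hu.mul h.Mt_unit
  -- Properness of K comes from the proper inverse of 1 + G J; the converse direction below needs
  -- it.
  have hKp : EntriesIn properSubring K := by
    have : K = J * ((Xh - Nh * Q) * Mt)⁻¹ := by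
      rw [← hKJ, Matrix.mul_nonsing_inv_cancel_right _ _ huX]
    rw [this]
    exact hJs.mul hp
  rw [h.denominator_mul_Mt Q, ← hJdef, Matrix.mul_add, Matrix.mul_one] at hKJ
  -- The relation K (1 + G J) = J shows that 1 + J G inverts 1 - K G, which moves J to the left of
  -- G.
  have hJK : J = K + J * G * K := by
    have h1 : (1 + J * G) * (1 - K * G) = 1 := by
      rw [mul_eq_one_comm, Matrix.mul_add, Matrix.mul_one, ← Matrix.mul_assoc, Matrix.sub_mul,
        Matrix.one_mul, Matrix.mul_assoc]
      nth_rewrite 1 [← hKJ]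
      rw [add_sub_cancel_right]
      abel
    have h2 : (1 - K * G) * J = K := by
      rw [Matrix.sub_mul, Matrix.one_mul, Matrix.mul_assoc]
      nth_rewrite 1 [← hKJ]
      rw [add_sub_cancel_right]
    calc J = (1 + J * G) * ((1 - K * G) * J) := by
            rw [← Matrix.mul_assoc, h1, Matrix.one_mul]
      _ = K + J * G * K := by rw [h2, Matrix.add_mul, Matrix.one_mul]
  rw [hG] at hQI hJK hKJ
  refine ⟨fun hKS => hQI.closedLoop_mem hG' hKS hJs hJK, fun hJS => ?_⟩
  -- For the converse, K = J - K G J is the same fixed-point equation with K and J exchanged and G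
  -- replaced by -G.
  have hQI' := hQI.neg
  rw [← smul_neg] at hQI'
  refine hQI'.closedLoop_mem hG'.neg hJS hKp ?_
  rw [smul_neg, Matrix.mul_neg, Matrix.neg_mul, Matrix.mul_assoc]
  exact eq_add_neg_of_add_eq hKJ

end IsDoublyCoprimeFactorization

end Youla

end TransferMatrix

namespace Plant

/-! ### Internal stability of the plant -/

variable {n p₁ p₂ q₁ q₂ : ℕ} (G : Plant n p₁ p₂ q₁ q₂)

theorem exists_G₂₂_eq : ∃ G' : TransferMatrix q₂ p₂, EntriesIn properSubring G' ∧
    G.G₂₂ = (RatFunc.X : RatFunc ℝ)⁻¹ • G' := by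
  obtain ⟨R, hR, h⟩ := exists_resolvent_eq G.A
  refine ⟨const G.C₂ * R * const G.B₂,
    (((const_stable _).mono stableSubring_le).mul hR).mul
      ((const_stable _).mono stableSubring_le), ?_⟩
  rw [G₂₂, resolvent, h, Matrix.mul_smul, Matrix.smul_mul]

/-- Multiply the resolvent by zI - A - LC, whose inverse is stable. What remains of the unstable
resolvent appears only behind `C₂`, that is, through the measured output. -/
theorem exists_outputInjection (hdet : Detectable G.A G.C₂) :
    ∃ (Φ : TransferMatrix n n) (L : TransferMatrix n q₂), EntriesIn stableSubring Φ ∧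
      EntriesIn stableSubring L ∧ G.resolvent = Φ - Φ * L * const G.C₂ * G.resolvent := by
  obtain ⟨L, hL⟩ := hdet
  refine ⟨_, const L, resolvent_stable _ hL, const_stable L, ?_⟩
  have hu := isUnit_det_smul_one_sub_const G.A
  have hv := isUnit_det_smul_one_sub_const (G.A + L * G.C₂)
  set z1 := (RatFunc.X : RatFunc ℝ) • (1 : TransferMatrix n n)
  have h1 : (z1 - const (G.A + L * G.C₂)) * G.resolvent =
      1 - const L * const G.C₂ * G.resolvent := by
    rw [const_add, const_mul, ← sub_sub, Matrix.sub_mul, resolvent, Matrix.mul_nonsing_inv _ hu]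
  rw [Matrix.mul_assoc, Matrix.mul_assoc, ← Matrix.mul_assoc (const L)]
  calc G.resolvent
      = (z1 - const (G.A + L * G.C₂))⁻¹ * ((z1 - const (G.A + L * G.C₂)) * G.resolvent) := by
        rw [Matrix.nonsing_inv_mul_cancel_left _ _ hv]
    _ = _ := by rw [h1, Matrix.mul_sub, Matrix.mul_one]

/-- Dual to output injection: the remaining resolvent appears only in front of `B₂`. -/
theorem exists_stateFeedback (hstab : Stabilizable G.A G.B₂) :
    ∃ (Φ : TransferMatrix n n) (F : TransferMatrix p₂ n), EntriesIn stableSubring Φ ∧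
      EntriesIn stableSubring F ∧ G.resolvent = Φ - G.resolvent * const G.B₂ * F * Φ := by
  obtain ⟨F, hF⟩ := hstab
  refine ⟨_, const F, resolvent_stable _ hF, const_stable F, ?_⟩
  have hu := isUnit_det_smul_one_sub_const G.A
  have hv := isUnit_det_smul_one_sub_const (G.A + G.B₂ * F)
  set z1 := (RatFunc.X : RatFunc ℝ) • (1 : TransferMatrix n n)
  have h1 : G.resolvent * (z1 - const (G.A + G.B₂ * F)) =
      1 - G.resolvent * const G.B₂ * const F := by
    rw [const_add, const_mul, ← sub_sub, Matrix.mul_sub, resolvent, Matrix.nonsing_inv_mul _ hu,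
      Matrix.mul_assoc]
  calc G.resolvent
      = (G.resolvent * (z1 - const (G.A + G.B₂ * F))) * (z1 - const (G.A + G.B₂ * F))⁻¹ := by
        rw [Matrix.mul_nonsing_inv_cancel_right _ _ hv]
    _ = _ := by rw [h1, Matrix.sub_mul, Matrix.one_mul]

/-- For a stabilizable and detectable plant, internal stability is that of the loop around
`G₂₂`. -/
theorem internallyStabilizedBy_iff (hstab : Stabilizable G.A G.B₂) (hdet : Detectable G.A G.C₂)
    (K : TransferMatrix p₂ q₂) :
    G.InternallyStabilizedBy K ↔ InternallyStabilizes G.G₂₂ K := by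
  refine ⟨fun h => ⟨h.1, h.2.1⟩, fun hK => ⟨hK.1, hK.2, ?_⟩⟩
  obtain ⟨H₁₁, H₁₂, H₂₁, H₂₂, hH, s11, s12, s21, s22, e1, -, e3, e4, e5⟩ :=
    InternallyStabilizes.exists_blocks hK.1 hK.2
  obtain ⟨ΦL, L, hΦL, hL, eL⟩ := G.exists_outputInjection hdet
  obtain ⟨ΦF, F, hΦF, hF, eF⟩ := G.exists_stateFeedback hstab
  have sB₁ := const_stable G.B₁
  have sB₂ := const_stable G.B₂
  have sC₁ := const_stable G.C₁
  have sC₂ := const_stable G.C₂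
  have sD₁₂ := const_stable G.D₁₂
  have sD₂₁ := const_stable G.D₂₁
  set Φ := G.resolvent
  have hG : G.G₂₂ = const G.C₂ * Φ * const G.B₂ := rfl
  -- These two identities trade a resolvent on the left or right of a loop block for a stable one,
  -- at the cost of a product with G₂₂ that the loop equations evaluate.
  have hrow : ∀ {m : ℕ} (W : TransferMatrix p₂ m),
      Φ * const G.B₂ * W = ΦL * (const G.B₂ * W - L * (G.G₂₂ * W)) := by
    intro m W
    conv_lhs => rw [eL]
    rw [hG]
    simp only [Matrix.mul_sub, Matrix.sub_mul, Matrix.mul_assoc]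
  have hcol : ∀ {m : ℕ} (W : TransferMatrix m q₂),
      W * const G.C₂ * Φ = (W * const G.C₂ - W * G.G₂₂ * F) * ΦF := by
    intro m W
    conv_lhs => rw [eF]
    rw [hG]
    simp only [Matrix.mul_sub, Matrix.sub_mul, Matrix.mul_assoc]
  have f12 : H₁₂ * G.G₂₂ = H₁₁ - 1 := by rw [← e1]; abel
  have f12' : G.G₂₂ * H₁₂ = H₂₂ - 1 := by rw [← e5]; abel
  have x1 : EntriesIn stableSubring (Φ * const G.B₂ * H₁₁) := by
    rw [hrow, ← e4]
    exact hΦL.mul ((sB₂.mul s11).sub (hL.mul s21))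
  have x2 : EntriesIn stableSubring (Φ * const G.B₂ * H₁₂) := by
    rw [hrow, f12']
    exact hΦL.mul ((sB₂.mul s12).sub (hL.mul (s22.sub EntriesIn.one)))
  have u1 : EntriesIn stableSubring (H₁₂ * const G.C₂ * Φ) := by
    rw [hcol, f12]
    exact ((s12.mul sC₂).sub ((s11.sub EntriesIn.one).mul hF)).mul hΦF
  have y1 : EntriesIn stableSubring (H₂₂ * const G.C₂ * Φ) := by
    rw [hcol, ← e3]
    exact ((s22.mul sC₂).sub (s21.mul hF)).mul hΦF
  -- The unstable resolvent stands on both sides. Output injection removes the left one and leaves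
  -- `u1` and `y1`, where state feedback has already removed the right one.
  have xd : EntriesIn stableSubring (Φ + Φ * const G.B₂ * H₁₂ * const G.C₂ * Φ) := by
    have : Φ + Φ * const G.B₂ * H₁₂ * const G.C₂ * Φ =
        ΦL * (1 + const G.B₂ * (H₁₂ * const G.C₂ * Φ) - L * (H₂₂ * const G.C₂ * Φ)) := by
      rw [hrow, f12']
      nth_rewrite 1 [eL]
      simp only [Matrix.mul_sub, Matrix.sub_mul, Matrix.mul_add, Matrix.mul_assoc,
        Matrix.mul_one]
      abel
    rw [this]
    exact hΦL.mul ((EntriesIn.one.add (sB₂.mul u1)).sub (hL.mul y1))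
  have w12 : EntriesIn stableSubring (H₁₂ * G.G₂₁) := by
    rw [G₂₁, Matrix.mul_add, ← Matrix.mul_assoc, ← Matrix.mul_assoc]
    exact (u1.mul sB₁).add (s12.mul sD₂₁)
  have w22 : EntriesIn stableSubring (H₂₂ * G.G₂₁) := by
    rw [G₂₁, Matrix.mul_add, ← Matrix.mul_assoc, ← Matrix.mul_assoc]
    exact (y1.mul sB₁).add (s22.mul sD₂₁)
  have v11 : EntriesIn stableSubring (G.G₁₂ * H₁₁) := by
    rw [G₁₂, Matrix.add_mul, Matrix.mul_assoc, Matrix.mul_assoc, ← Matrix.mul_assoc]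
    rw [Matrix.mul_assoc, ← Matrix.mul_assoc G.resolvent]
    exact (sC₁.mul x1).add (sD₁₂.mul s11)
  have v12 : EntriesIn stableSubring (G.G₁₂ * H₁₂) := by
    rw [G₁₂, Matrix.add_mul, Matrix.mul_assoc, Matrix.mul_assoc, ← Matrix.mul_assoc]
    rw [Matrix.mul_assoc, ← Matrix.mul_assoc G.resolvent]
    exact (sC₁.mul x2).add (sD₁₂.mul s12)
  have hrows : (loop G.G₂₂ K)⁻¹ * Matrix.fromRows (0 : TransferMatrix p₂ p₁) G.G₂₁ =
      Matrix.fromRows (H₁₂ * G.G₂₁) (H₂₂ * G.G₂₁) := by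
    rw [hH, Matrix.fromBlocks_mul_fromRows]
    simp
  have hcols : Matrix.fromCols G.G₁₂ (0 : TransferMatrix q₁ q₂) * (loop G.G₂₂ K)⁻¹ =
      Matrix.fromCols (G.G₁₂ * H₁₁) (G.G₁₂ * H₁₂) := by
    rw [hH, Matrix.fromCols_mul_fromBlocks]
    simp
  refine ⟨?_, ?_, ?_⟩
  · rw [hrows]
    rintro (i | i) j
    exacts [w12 i j, w22 i j]
  · rw [hcols]
    rintro i (j | j)
    exacts [v11 i j, v12 i j]
  · have hsum : G.G₁₁ + Matrix.fromCols G.G₁₂ (0 : TransferMatrix q₁ q₂) * (loop G.G₂₂ K)⁻¹ *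
        Matrix.fromRows (0 : TransferMatrix p₂ p₁) G.G₂₁ =
        const G.C₁ * (Φ + Φ * const G.B₂ * H₁₂ * const G.C₂ * Φ) * const G.B₁ +
          const G.C₁ * (Φ * const G.B₂ * H₁₂) * const G.D₂₁ +
          const G.D₁₂ * (H₁₂ * G.G₂₁) := by
      rw [hcols, Matrix.fromCols_mul_fromRows, Matrix.mul_zero, zero_add, G₁₁, G₁₂, G₂₁]
      simp only [Matrix.mul_add, Matrix.add_mul, Matrix.mul_assoc]
      abel
    rw [hsum]
    exact (((sC₁.mul xd).mul sB₁).add ((sC₁.mul x2).mul sD₂₁)).add (sD₁₂.mul w12)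

end Plant

/-! ### Splitting the Youla parameter and assembling the theorem -/

namespace TransferMatrix

/-- A stable matrix is the sum of a real FIR matrix and a delayed stable matrix. -/
theorem stable_iff_exists_delayed_add_RXp {N a b : ℕ} {Q : TransferMatrix a b} :
    EntriesIn stableSubring Q ↔
      ∃ U ∈ delayed (N + 1) (RHinf a b), ∃ V ∈ RXp N a b, Q = U + V := by
  constructor
  · intro hQ
    obtain ⟨V, R, -, hR, h⟩ := exists_eq_sum_add_delay (hQ.mono stableSubring_le) (N + 1)
    exact ⟨_, ⟨R, hR hQ, rfl⟩, _, ⟨V, rfl⟩, by rw [h, add_comm]⟩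
  · rintro ⟨_, ⟨R, hR, rfl⟩, _, ⟨V, rfl⟩, rfl⟩
    exact (EntriesIn.smul (delay_stable _) hR).add
      (EntriesIn.sum fun i _ => (const_stable _).smul (delay_stable i))

/-- The closed-loop map is affine in the parameter, and U changes it by -Mh U Mt, which lies in S
because of its N + 1 delays. -/
theorem IsDoublyCoprimeFactorization.mem_SSpace_iff_projection {p q N : ℕ}
    {pat : ℕ → Fin p → Fin q → Prop} {G G' : TransferMatrix q p} {K : TransferMatrix p q}
    {Mh : TransferMatrix p p} {Nh : TransferMatrix q p} {Xh : TransferMatrix q q}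
    {Yh : TransferMatrix p q} {Mt : TransferMatrix q q} {Nt : TransferMatrix q p}
    {Xt : TransferMatrix p p} {Yt : TransferMatrix p q}
    (h : IsDoublyCoprimeFactorization G Mh Nh Xh Yh Mt Nt Xt Yt)
    (hG' : EntriesIn properSubring G') (hG : G = (RatFunc.X : RatFunc ℝ)⁻¹ • G')
    (hQI : QuadraticallyInvariant (SSpace N pat) G)
    {U V : TransferMatrix p q} (hU : U ∈ delayed (N + 1) (RHinf p q)) (hV : V ∈ RXp N p q)
    (hK : K = (Yh - Mh * (U + V)) * (Xh - Nh * (U + V))⁻¹) :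
    K ∈ SSpace N pat ↔ ∃ P ∈ YSpace N pat, IsXpProjection N ((Yh - Mh * V) * Mt) P := by
  have hQ : EntriesIn stableSubring (U + V) :=
    stable_iff_exists_delayed_add_RXp.2 ⟨U, hU, V, hV, rfl⟩
  -- V alone is a stable parameter, obtained with U = 0.
  have hVs : EntriesIn stableSubring V :=
    stable_iff_exists_delayed_add_RXp (N := N).2
      ⟨0, ⟨0, EntriesIn.zero (S := stableSubring), by simp⟩, V, hV, by simp⟩
  rw [h.mem_SSpace_iff hG' hG hQI hQ hK,
    ← TransferMatrix.mem_SSpace_iff_projection ((h.closedLoop_stable hVs).mono stableSubring_le)]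
  obtain ⟨R, hR, rfl⟩ := hU
  have hD : Mh * delay (N + 1) • R * Mt ∈ SSpace N pat := by
    rw [Matrix.mul_smul, Matrix.smul_mul]
    exact SSpace.delay_smul_mem (EntriesIn.mono stableSubring_le
      (EntriesIn.mul (EntriesIn.mul (S := stableSubring) h.Mh_stable hR) h.Mt_stable))
  have hsplit : (Yh - Mh * (delay (N + 1) • R + V)) * Mt =
      (Yh - Mh * V) * Mt + -(Mh * delay (N + 1) • R * Mt) := by
    simp only [Matrix.mul_add, Matrix.sub_mul, Matrix.add_mul]
    abel
  rw [hsplit]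
  refine ⟨fun hS => ?_, fun hS => SSpace.add hS (SSpace.neg hD)⟩
  simpa using SSpace.add hS hD

end TransferMatrix

end

theorem theorem2 {n p₁ p₂ q₁ q₂ : ℕ} (G : Plant n p₁ p₂ q₁ q₂)
    (hstab : Stabilizable G.A G.B₂) (hdet : Detectable G.A G.C₂)
    (N : ℕ) (pat : ℕ → Fin p₂ → Fin q₂ → Prop)
    (hQI : QuadraticallyInvariant (SSpace N pat) G.G₂₂)
    (Mh : TransferMatrix p₂ p₂) (Nh : TransferMatrix q₂ p₂)
    (Xh : TransferMatrix q₂ q₂) (Yh : TransferMatrix p₂ q₂)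
    (Mt : TransferMatrix q₂ q₂) (Nt : TransferMatrix q₂ p₂)
    (Xt : TransferMatrix p₂ p₂) (Yt : TransferMatrix p₂ q₂)
    (hdcf : IsDoublyCoprimeFactorization G.G₂₂ Mh Nh Xh Yh Mt Nt Xt Yt) :
    (∀ U ∈ delayed (N + 1) (RHinf p₂ q₂), ∀ V ∈ RXp N p₂ q₂, IsUnit (Xh - Nh * (U + V)).det) ∧
    ∀ K : TransferMatrix p₂ q₂,
      ((K ∈ SSpace N pat ∧ G.InternallyStabilizedBy K) ↔
        ∃ U ∈ delayed (N + 1) (RHinf p₂ q₂), ∃ V ∈ RXp N p₂ q₂,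
          K = (Yh - Mh * (U + V)) * (Xh - Nh * (U + V))⁻¹ ∧
          ∃ P ∈ YSpace N pat, IsXpProjection N ((Yh - Mh * V) * Mt) P) ∧
      ((K ∈ SSpace N pat ∧ InternallyStabilizes G.G₂₂ K) ↔
        ∃ U ∈ delayed (N + 1) (RHinf p₂ q₂), ∃ V ∈ RXp N p₂ q₂,
          K = (Yh - Mh * (U + V)) * (Xh - Nh * (U + V))⁻¹ ∧
          ∃ P ∈ YSpace N pat, IsXpProjection N ((Yh - Mh * V) * Mt) P) := by
  obtain ⟨G', hG', hG⟩ := G.exists_G₂₂_eq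
  have main : ∀ K : TransferMatrix p₂ q₂,
      (K ∈ SSpace N pat ∧ InternallyStabilizes G.G₂₂ K) ↔
        ∃ U ∈ delayed (N + 1) (RHinf p₂ q₂), ∃ V ∈ RXp N p₂ q₂,
          K = (Yh - Mh * (U + V)) * (Xh - Nh * (U + V))⁻¹ ∧
          ∃ P ∈ YSpace N pat, IsXpProjection N ((Yh - Mh * V) * Mt) P := by
    intro K
    constructor
    · rintro ⟨hKS, hK⟩
      obtain ⟨Q, hQ, hKQ⟩ := hdcf.exists_parameter hG' hG hK
      obtain ⟨U, hU, V, hV, rfl⟩ := stable_iff_exists_delayed_add_RXp (N := N).1 hQ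
      exact ⟨U, hU, V, hV, hKQ,
        (hdcf.mem_SSpace_iff_projection hG' hG hQI hU hV hKQ).1 hKS⟩
    · rintro ⟨U, hU, V, hV, hKQ, hP⟩
      exact ⟨(hdcf.mem_SSpace_iff_projection hG' hG hQI hU hV hKQ).2 hP,
        hdcf.internallyStabilizes hG' hG
          (stable_iff_exists_delayed_add_RXp.2 ⟨U, hU, V, hV, rfl⟩) hKQ⟩
  refine ⟨fun U hU V hV => (hdcf.denominator_isUnit hG' hG
    (stable_iff_exists_delayed_add_RXp.2 ⟨U, hU, V, hV, rfl⟩)).1, fun K => ⟨?_, main K⟩⟩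
  rw [G.internallyStabilizedBy_iff hstab hdet]
  exact main K
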